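/- Let $(\Omega,\mathcal F,P)$ be a nonatomic, complete probability space and let $(\Theta,\Sigma)$ be a measurable space. Let $\zeta:\Omega\to\Theta$ be a random element, and let $\zeta^1,\zeta^2,\ldots:\Omega\to\Theta$ be independent random elements, each with the same distribution as $\zeta$. Let $1\le p<\infty$. Let $Y_0$ be a closed, separable subset of a real Banach space $Y$, and let $W_0$ be a closed, convex subset of a separable, reflexive real Banach space $W$. Let $\Psi:Y_0\times\Theta\to\mathbb R$ satisfy the following conditions. 1. $\Psi$ is random lower semicontinuous, that is, it is jointly measurable with respect to $\mathcal B(Y_0)\otimes\Sigma$, and $\Psi(\cdot,\theta)$ is lower semicontinuous for every $\theta\in\Theta$. 2. For each $y\in Y_0$, the random variable $\Psi_y:=\Psi(y,\zeta(\cdot))$ belongs to $L^p(\Omega,\mathcal F,P)$. 3. For each $\bar y\in Y_0$ there are a neighborhood $U$ of $\bar y$ in $Y_0$ and $h\in L^p(\Omega,\mathcal F,P)$ such that, for $P$-almost every $\omega$, $\Psi(y,\zeta(\omega))\ge h(\omega)$ for all $y\in U$. Let $\rho:L^p(\Omega,\mathcal F,P)\to\mathbb R$ be a law invariant, convex risk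 measure. That is, $\rho$ is convex; it is monotone ($X\le X'$ almost surely implies $\rho(X)\le\rho(X')$); it satisfies $\rho(X+c)=\rho(X)+c$ for all $c\in\mathbb R$; and $\rho(X)=\rho(X')$ whenever $X$ and $X'$ have the same distribution function. If $F$ is the distribution function of some $X\in L^p(\Omega,\mathcal F,P)$, write $\rho(F):=\rho(X)$. For $y\in Y_0$ and $N\ge 1$, let $\hat H_{y,N}=\hat H_{y,N,\omega}$ be the empirical distribution function of the sample $\Psi(y,\zeta^1(\omega)),\ldots,\Psi(y,\zeta^N(\omega))$. Let $B:W\to Y$ be linear and completely continuous (that is, $w_k\rightharpoonup w$ in $W$ implies $Bw_k\to Bw$ in $Y$), with $B(W_0)\subset Y_0$. Then, for $P$-almost every $\omega$, the functions $W_0\ni w\mapsto\rho(\hat H_{Bw,N,\omega})$ Mosco-epiconverge on $W_0$ to $W_0\ni w\mapsto\rho(\Psi_{Bw})$ as $N\to\infty$. That is, for every $w\in W_0$: - for every sequence $(w_N)\subset W_0$ with $w_N\rightharpoonup w$, $\liminf_{N\to\infty}\rho(\hat H_{Bw_N,N,\omega})\ge\rho(\Psi_{Bw})$; - there is a sequence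 $(w_N)\subset W_0$ with $w_N\to w$ and $\limsup_{N\to\infty}\rho(\hat H_{Bw_N,N,\omega})\le\rho(\Psi_{Bw})$. -/

import Mathlib

open MeasureTheory ProbabilityTheory Filter Topology
open scoped ENNReal

noncomputable section

/-- A normed space is reflexive if the canonical embedding into its bidual is onto. -/
def IsReflexive (W : Type*) [NormedAddCommGroup W] [NormedSpace ℝ W] : Prop :=
  Function.Surjective (NormedSpace.inclusionInDoubleDual ℝ W)

/-- Weak convergence of a sequence: convergence in the weak topology. -/
def WeaklyTendsto {W : Type*} [NormedAddCommGroup W] [NormedSpace ℝ W]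
    (w : ℕ → W) (w₀ : W) : Prop :=
  Tendsto (fun k => toWeakSpace ℝ W (w k)) atTop (𝓝 (toWeakSpace ℝ W w₀))

/-- Weak convergence is convergence of the values of every continuous linear functional. -/
theorem weaklyTendsto_iff {W : Type*} [NormedAddCommGroup W] [NormedSpace ℝ W]
    (w : ℕ → W) (w₀ : W) :
    WeaklyTendsto w w₀ ↔ ∀ f : StrongDual ℝ W, Tendsto (fun k => f (w k)) atTop (𝓝 (f w₀)) :=
  WeakBilin.tendsto_iff_forall_eval_tendsto (B := (topDualPairing ℝ W).flip)
    (fun x y h => by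
      by_contra hne
      obtain ⟨f, hf⟩ := SeparatingDual.exists_separating_of_ne (R := ℝ) hne
      exact hf (DFunLike.congr_fun h f))

/-- A mapping is completely continuous if it maps weakly convergent sequences to strongly
convergent ones (with the corresponding limit). -/
def CompletelyContinuous {W Y : Type*} [NormedAddCommGroup W] [NormedSpace ℝ W]
    [TopologicalSpace Y] (G : W → Y) : Prop :=
  ∀ (w : ℕ → W) (w₀ : W), WeaklyTendsto w w₀ → Tendsto (fun k => G (w k)) atTop (𝓝 (G w₀))

/-- Mosco-epiconvergence on a subset `V₀` of a normed space: the liminf inequality holds along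
weakly convergent sequences in `V₀`, and there are strongly convergent recovery sequences
in `V₀`. -/
def MoscoEpiconverges {V : Type*} [NormedAddCommGroup V] [NormedSpace ℝ V] {V₀ : Set V}
    (φ : ℕ → V₀ → EReal) (φ₀ : V₀ → EReal) : Prop :=
  ∀ v : V₀,
    (∀ u : ℕ → V₀, WeaklyTendsto (fun k => (u k : V)) (v : V) →
      φ₀ v ≤ liminf (fun k => φ k (u k)) atTop) ∧
    (∃ u : ℕ → V₀, Tendsto (fun k => (u k : V)) atTop (𝓝 (v : V)) ∧
      limsup (fun k => φ k (u k)) atTop ≤ φ₀ v)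

/-- A measure is nonatomic if every measurable set of positive measure contains a measurable
subset of strictly smaller positive measure. (Mathlib's `NoAtoms` only says that points are
null.) -/
def IsNonatomic {Ω : Type*} [MeasurableSpace Ω] (P : Measure Ω) : Prop :=
  ∀ A : Set Ω, MeasurableSet A → 0 < P A →
    ∃ B : Set Ω, MeasurableSet B ∧ B ⊆ A ∧ 0 < P B ∧ P B < P A

/-- `Ψ : V × Θ → ℝ` is random lower semicontinuous: jointly measurable with respect to the
product of the Borel σ-algebra of `V` and the σ-algebra of `Θ`, and lower semicontinuous in its
first argument. -/
structure IsRandomLSC {V Θ : Type*} [TopologicalSpace V] [MeasurableSpace V] [BorelSpace V]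
    [MeasurableSpace Θ] (Ψ : V → Θ → ℝ) : Prop where
  measurable_uncurry : Measurable (Function.uncurry Ψ)
  lowerSemicontinuous : ∀ θ : Θ, LowerSemicontinuous (fun v => Ψ v θ)

/-- A convex risk measure on `L^p`: convex, monotone, translation equivariant. The order on `Lp`
is the almost sure order. -/
structure IsConvexRiskMeasure {Ω : Type*} [MeasurableSpace Ω] {P : Measure Ω} [IsFiniteMeasure P]
    {p : ℝ≥0∞} (ρ : Lp ℝ p P → ℝ) : Prop where
  convex : ∀ (X Y : Lp ℝ p P) (t : ℝ), 0 < t → t < 1 →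
    ρ (t • X + (1 - t) • Y) ≤ t * ρ X + (1 - t) * ρ Y
  monotone : ∀ X Y : Lp ℝ p P, X ≤ Y → ρ X ≤ ρ Y
  translation : ∀ (X : Lp ℝ p P) (c : ℝ), ρ (X + Lp.const p P c) = ρ X + c

/-- `X` has distribution function `F`, i.e. `P (X ≤ t) = F t` for all `t`. -/
def HasDistributionFunction {Ω : Type*} [MeasurableSpace Ω] {P : Measure Ω} {p : ℝ≥0∞}
    (X : Lp ℝ p P) (F : ℝ → ℝ) : Prop :=
  ∀ t : ℝ, P.real {ω | X ω ≤ t} = F t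

/-- A functional on `L^p` is law invariant if it takes equal values at random variables with
equal distribution functions. -/
def IsLawInvariant {Ω : Type*} [MeasurableSpace Ω] {P : Measure Ω} {p : ℝ≥0∞}
    (ρ : Lp ℝ p P → ℝ) : Prop :=
  ∀ X Y : Lp ℝ p P, (∀ t : ℝ, P {ω | X ω ≤ t} = P {ω | Y ω ≤ t}) → ρ X = ρ Y

open Classical in
/-- `ρ(F)` for a distribution function `F`: the value of `ρ` at any `X ∈ L^p` with distribution
function `F`. For law invariant `ρ` the choice of `X` is irrelevant (`riskOfDistribution_eq`).
The default value `0` is taken only if there is no such `X`. -/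
def riskOfDistribution {Ω : Type*} [MeasurableSpace Ω] {P : Measure Ω} {p : ℝ≥0∞}
    (ρ : Lp ℝ p P → ℝ) (F : ℝ → ℝ) : ℝ :=
  if h : ∃ X : Lp ℝ p P, HasDistributionFunction X F then ρ h.choose else 0

theorem riskOfDistribution_eq {Ω : Type*} [MeasurableSpace Ω] {P : Measure Ω}
    [IsFiniteMeasure P] {p : ℝ≥0∞} {ρ : Lp ℝ p P → ℝ} (hρ : IsLawInvariant ρ)
    {X : Lp ℝ p P} {F : ℝ → ℝ} (hX : HasDistributionFunction X F) :
    riskOfDistribution ρ F = ρ X := by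
  have h : ∃ X : Lp ℝ p P, HasDistributionFunction X F := ⟨X, hX⟩
  rw [riskOfDistribution, dif_pos h]
  refine hρ _ _ fun t => ?_
  have := (h.choose_spec t).trans (hX t).symm
  exact (measureReal_eq_measureReal_iff).1 this

/-- The empirical distribution function of the first `N` entries of the sample `x`
(of interest for `N ≥ 1`). -/
def empiricalCDF (x : ℕ → ℝ) (N : ℕ) (t : ℝ) : ℝ :=
  (((Finset.range N).filter (fun i => x i ≤ t)).card : ℝ) / N

end

/-! The core is strong consistency for one measurable `V : Θ → ℝ` with `V ∘ ζ` in `L^p`. By the law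
of large numbers, the empirical distribution functions converge almost surely at all rationals, and
so do the `p`-th absolute moments. One uniform variable on the nonatomic space realises all these
laws on `Ω` through their quantile functions. These realisations converge almost surely, hence in
`L^p` by Riesz–Scheffé. A finite convex monotone translation equivariant `ρ` is norm continuous, and
by law invariance it sees only the laws, so the risks converge.

The exceptional null set depends on `V`, so only countably many `V` may be used. For the liminf
inequality they are the infima of `Ψ` over sets of a countable basis of `Y₀`, which are almost
everywhere measurable by the projection theorem. Complete continuity makes `B w_N` converge
strongly, so these infima eventually bound the sampled values from below. Shrinking the basic set
recovers `ρ(Ψ_{Bw})` by lower semicontinuity and domination. For recovery sequences, consistency is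
used on a countable subset of `W₀` over which the graph of the limit functional is dense, followed
by a diagonal choice. -/

/-! ### Continuity of convex risk measures -/

/-- A finite convex risk measure on `L^p` is bounded above near the origin. -/
theorem IsConvexRiskMeasure.exists_bound_near_zero {Ω : Type*} [MeasurableSpace Ω] {P : Measure Ω}
    [IsFiniteMeasure P] {p : ℝ≥0∞} [Fact (1 ≤ p)] {ρ : Lp ℝ p P → ℝ}
    (hρ : IsConvexRiskMeasure ρ) :
    ∃ δ > 0, ∃ M : ℝ, ∀ Z : Lp ℝ p P, ‖Z‖ < δ → ρ Z ≤ M := by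
  -- Otherwise some `Z n` with norm below `2⁻ⁿ` have `ρ (Z n) > n`. The sum of all `|Z n|` lies in
  -- `L^p` and dominates each of them, so monotonicity would make its risk exceed every `n`.
  by_contra! hcon
  choose Z hZ hρZ using fun n : ℕ => hcon ((1 / 2 : ℝ) ^ n) (by positivity) n
  have hsum : Summable (fun n => |Z n|) := by
    refine Summable.of_norm_bounded (g := fun n : ℕ => (1 / 2 : ℝ) ^ n)
      (summable_geometric_of_lt_one (by norm_num) (by norm_num)) fun n => ?_
    rw [norm_abs_eq_norm]
    exact (hZ n).le
  obtain ⟨n, hn⟩ := exists_nat_gt (ρ (∑' n, |Z n|))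
  have h1 : Z n ≤ ∑' n, |Z n| :=
    (le_abs_self _).trans (hsum.le_tsum n fun i _ => abs_nonneg (Z i))
  linarith [hρ.monotone _ _ h1, hρZ n]

/-- A finite convex risk measure on `L^p` is continuous. -/
theorem IsConvexRiskMeasure.continuous {Ω : Type*} [MeasurableSpace Ω] {P : Measure Ω}
    [IsFiniteMeasure P] {p : ℝ≥0∞} [Fact (1 ≤ p)] {ρ : Lp ℝ p P → ℝ}
    (hρ : IsConvexRiskMeasure ρ) : Continuous ρ := by
  have hconv : ConvexOn ℝ Set.univ ρ := by
    refine ⟨convex_univ, fun X _ Y _ a b ha hb hab => ?_⟩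
    rcases ha.eq_or_lt with rfl | ha
    · obtain rfl : b = 1 := by linarith
      simp
    rcases hb.eq_or_lt with rfl | hb
    · obtain rfl : a = 1 := by linarith
      simp
    obtain rfl : b = 1 - a := by linarith
    exact hρ.convex X Y a ha (by linarith)
  obtain ⟨δ, hδ, M, hM⟩ := hρ.exists_bound_near_zero
  rw [← continuousOn_univ]
  have hbdd : (𝓝 (0 : Lp ℝ p P)).IsBoundedUnder (· ≤ ·) ρ := by
    refine isBoundedUnder_of_eventually_le (a := M) ?_
    filter_upwards [Metric.ball_mem_nhds (0 : Lp ℝ p P) hδ] with Z hZ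
    exact hM Z (by simpa using hZ)
  -- A convex function bounded above near one point is continuous throughout the open domain.
  refine ((hconv.continuousOn_tfae isOpen_univ Set.univ_nonempty).out 3 1).mp ?_
  exact ⟨0, Set.mem_univ _, hbdd⟩

/-! ### Uniform variables on nonatomic spaces -/

/-- Every real function on a set takes values cofinal in its range along a countable subset. -/
theorem exists_countable_subset_cofinal {α : Type*} (S : Set α) (f : α → ℝ) :
    ∃ T ⊆ S, T.Countable ∧ ∀ a ∈ S, ∃ t ∈ T, f a ≤ f t := by
  by_cases hmax : ∃ m ∈ S, ∀ a ∈ S, f a ≤ f m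
  · obtain ⟨m, hm, hmax⟩ := hmax
    exact ⟨{m}, by simpa using hm, Set.countable_singleton m, fun a ha => ⟨m, rfl, hmax a ha⟩⟩
  push Not at hmax
  have hchoose : ∀ q : ℚ, ∃ T : Set α, T ⊆ S ∧ T.Countable ∧
      ((∃ a ∈ S, (q : ℝ) < f a) → ∃ a ∈ T, (q : ℝ) < f a) := by
    intro q
    by_cases hq : ∃ a ∈ S, (q : ℝ) < f a
    · obtain ⟨a, ha, hqa⟩ := hq
      exact ⟨{a}, by simpa using ha, Set.countable_singleton a, fun _ => ⟨a, rfl, hqa⟩⟩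
    · exact ⟨∅, by simp, Set.countable_empty, fun h => absurd h hq⟩
  choose T hTS hTc hT using hchoose
  refine ⟨⋃ q, T q, Set.iUnion_subset hTS, Set.countable_iUnion hTc, fun a ha => ?_⟩
  obtain ⟨b, hb, hab⟩ := hmax a ha
  obtain ⟨q, haq, hqb⟩ := exists_rat_btwn hab
  obtain ⟨t, ht, hqt⟩ := hT q ⟨b, hb, hqb⟩
  exact ⟨t, Set.mem_iUnion.2 ⟨q, ht⟩, (haq.trans hqt).le⟩

/-- The union of a countable chain of sets of measure at most `c` has measure at most `c`. -/
theorem measureReal_biUnion_le_of_chain {Ω ι : Type*} [MeasurableSpace Ω] {P : Measure Ω}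
    [IsFiniteMeasure P] {T : Set ι} (hT : T.Countable) {s : ι → Set Ω} {c : ℝ} (hc : 0 ≤ c)
    (hchain : ∀ i ∈ T, ∀ j ∈ T, s i ⊆ s j ∨ s j ⊆ s i) (hle : ∀ i ∈ T, P.real (s i) ≤ c) :
    P.real (⋃ i ∈ T, s i) ≤ c := by
  have hdir : DirectedOn (Function.onFun (· ⊆ ·) s) T := by
    intro i hi j hj
    rcases hchain i hi j hj with h | h
    · exact ⟨j, hj, h, subset_rfl⟩
    · exact ⟨i, hi, subset_rfl, h⟩
  refine ENNReal.toReal_le_of_le_ofReal hc ?_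
  rw [measure_biUnion_eq_iSup hT hdir]
  refine iSup₂_le fun i hi => ?_
  rw [← ofReal_measureReal]
  exact ENNReal.ofReal_le_ofReal (hle i hi)

/-- A nonatomic probability space carries an increasing family of events `D t` of
probability `t`. -/
theorem IsNonatomic.exists_monotone_family {Ω : Type*} [MeasurableSpace Ω] {P : Measure Ω}
    [IsProbabilityMeasure P] (hP : IsNonatomic P) :
    ∃ D : ℝ → Set Ω, Monotone D ∧
      ∀ t ∈ Set.Icc (0 : ℝ) 1, MeasurableSet (D t) ∧ P.real (D t) = t := by
  -- Take a maximal chain of events, ordered by inclusion with strictly growing probability. At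
  -- level `c`, let `H` be the union of the members of probability at most `c` and `G` the
  -- intersection of the others. If `P H ≠ c`, nonatomicity inserts a set strictly between `H` and
  -- `G` in measure, comparable with every member, contradicting maximality.
  let r : {A : Set Ω // MeasurableSet A} → {A : Set Ω // MeasurableSet A} → Prop :=
    fun A B => A.1 ⊆ B.1 ∧ P.real A.1 < P.real B.1
  obtain ⟨hC, hCmax⟩ : IsMaxChain r (maxChain r) := maxChain_spec
  set C := maxChain r
  have hsub : ∀ A ∈ C, ∀ B ∈ C, P.real A.1 ≤ P.real B.1 → A.1 ⊆ B.1 := by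
    intro A hA B hB hAB
    by_cases h : A = B
    · rw [h]
    · rcases hC hA hB h with h | h
      · exact h.1
      · exact absurd h.2 hAB.not_gt
  have hmem : ∀ E : {A : Set Ω // MeasurableSet A}, (∀ B ∈ C, r E B ∨ r B E) → E ∈ C := by
    intro E hE
    rw [hCmax (hC.insert fun b hb _ => hE b hb) (Set.subset_insert _ _)]
    exact Set.mem_insert _ _
  refine ⟨fun c => ⋃ B ∈ {B ∈ C | P.real B.1 ≤ c}, B.1, fun c d hcd => ?_, fun c hc => ?_⟩
  · exact Set.biUnion_subset_biUnion_left fun B hB => ⟨hB.1, hB.2.trans hcd⟩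
  -- Countable cofinal subfamilies make the union and the intersection measurable.
  obtain ⟨T, hTS, hTc, hT⟩ := exists_countable_subset_cofinal {B ∈ C | P.real B.1 ≤ c}
    fun B => P.real B.1
  obtain ⟨T', hTS', hTc', hT'⟩ := exists_countable_subset_cofinal {B ∈ C | c < P.real B.1}
    fun B => -P.real B.1
  have hH : (⋃ B ∈ {B ∈ C | P.real B.1 ≤ c}, B.1) = ⋃ B ∈ T, B.1 := by
    refine (Set.iUnion₂_subset fun B hB => ?_).antisymm (Set.biUnion_subset_biUnion_left hTS)
    obtain ⟨t, ht, hBt⟩ := hT B hB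
    exact (hsub B hB.1 t (hTS ht).1 hBt).trans (Set.subset_biUnion_of_mem (u := Subtype.val) ht)
  have hHle : ∀ B ∈ C, P.real B.1 ≤ c → B.1 ⊆ ⋃ B ∈ T, B.1 := fun B hB hBc => by
    rw [← hH]
    exact Set.subset_biUnion_of_mem (u := Subtype.val) (⟨hB, hBc⟩ : B ∈ {B ∈ C | P.real B.1 ≤ c})
  have hGle : ∀ B ∈ C, c < P.real B.1 → (⋂ B ∈ T', B.1) ⊆ B.1 := fun B hB hBc => by
    obtain ⟨t, ht, hBt⟩ := hT' B ⟨hB, hBc⟩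
    exact (Set.biInter_subset_of_mem (t := Subtype.val) ht).trans
      (hsub t (hTS' ht).1 B hB (by simpa using hBt))
  have htot : ∀ A ∈ C, ∀ B ∈ C, A.1 ⊆ B.1 ∨ B.1 ⊆ A.1 := fun A hA B hB =>
    (le_total (P.real A.1) (P.real B.1)).imp (hsub A hA B hB) (hsub B hB A hA)
  have hHm : MeasurableSet (⋃ B ∈ T, B.1) := MeasurableSet.biUnion hTc fun B _ => B.2
  have hGm : MeasurableSet (⋂ B ∈ T', B.1) := MeasurableSet.biInter hTc' fun B _ => B.2
  have hPH : P.real (⋃ B ∈ T, B.1) ≤ c :=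
    measureReal_biUnion_le_of_chain hTc hc.1
      (fun i hi j hj => htot i (hTS hi).1 j (hTS hj).1) fun i hi => (hTS hi).2
  have hPG : c ≤ P.real (⋂ B ∈ T', B.1) := by
    have h : P.real (⋃ B ∈ T', B.1ᶜ) ≤ 1 - c := by
      refine measureReal_biUnion_le_of_chain hTc' (by linarith [hc.2]) (fun i hi j hj => ?_) ?_
      · simp only [Set.compl_subset_compl]
        exact htot j (hTS' hj).1 i (hTS' hi).1
      · intro i hi
        rw [probReal_compl_eq_one_sub i.2]
        linarith [(hTS' hi).2]
    have h2 : (⋃ B ∈ T', B.1ᶜ) = (⋂ B ∈ T', B.1)ᶜ := by simp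
    rw [h2, probReal_compl_eq_one_sub hGm] at h
    linarith
  have hHG : (⋃ B ∈ T, B.1) ⊆ ⋂ B ∈ T', B.1 := by
    refine Set.iUnion₂_subset fun A hA => Set.subset_iInter₂ fun B hB => ?_
    exact hsub A (hTS hA).1 B (hTS' hB).1 ((hTS hA).2.trans (hTS' hB).2.le)
  beta_reduce
  rw [hH]
  refine ⟨hHm, ?_⟩
  set H := ⋃ B ∈ T, B.1
  set G := ⋂ B ∈ T', B.1
  clear_value H G
  by_contra hne
  have hlt : P.real H < P.real G := (lt_of_le_of_ne hPH hne).trans_le hPG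
  have hdiff : P.real (G \ H) = P.real G - P.real H := measureReal_sdiff hHG hHm
  obtain ⟨E, hEm, hEsub, hE0, hElt⟩ := hP (G \ H) (hGm.diff hHm)
    (pos_iff_ne_zero.2 fun h0 => by rw [measureReal_def, h0] at hdiff; simp at hdiff; linarith)
  have hE0' : 0 < P.real E := ENNReal.toReal_pos hE0.ne' (by finiteness)
  have hElt' : P.real E < P.real (G \ H) := ENNReal.toReal_strict_mono (by finiteness) hElt
  have hHE : P.real (H ∪ E) = P.real H + P.real E :=
    measureReal_union (Set.disjoint_left.2 fun x hx hxE => (hEsub hxE).2 hx) hEm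
  have hEG : H ∪ E ⊆ G := Set.union_subset hHG (hEsub.trans Set.sdiff_subset)
  have hEC : (⟨H ∪ E, hHm.union hEm⟩ : {A : Set Ω // MeasurableSet A}) ∈ C := by
    refine hmem _ fun B hB => ?_
    rcases le_or_gt (P.real B.1) c with hBc | hBc
    · refine Or.inr ⟨(hHle B hB hBc).trans Set.subset_union_left, ?_⟩
      have := measureReal_mono (μ := P) (hHle B hB hBc)
      change P.real B.1 < P.real (H ∪ E)
      linarith
    · refine Or.inl ⟨hEG.trans (hGle B hB hBc), ?_⟩
      have := measureReal_mono (μ := P) (hGle B hB hBc)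
      change P.real (H ∪ E) < P.real B.1
      linarith
  rcases le_or_gt (P.real (H ∪ E)) c with hBc | hBc
  · have := measureReal_mono (μ := P) (hHle _ hEC hBc)
    change P.real (H ∪ E) ≤ P.real H at this
    linarith
  · have := measureReal_mono (μ := P) (hGle _ hEC hBc)
    change P.real G ≤ P.real (H ∪ E) at this
    linarith

/-- `U` is uniformly distributed on `(0, 1)`. -/
structure IsUniformVariable {Ω : Type*} [MeasurableSpace Ω] (P : Measure Ω) (U : Ω → ℝ) :
    Prop where
  measurable : Measurable U
  mem_Ioo : ∀ ω, U ω ∈ Set.Ioo (0 : ℝ) 1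
  measureReal_le : ∀ t ∈ Set.Icc (0 : ℝ) 1, P.real {ω | U ω ≤ t} = t

/-- A nonatomic probability space carries a random variable uniformly distributed
on `(0, 1)`. -/
theorem IsNonatomic.exists_uniform {Ω : Type*} [MeasurableSpace Ω] {P : Measure Ω}
    [IsProbabilityMeasure P] (hP : IsNonatomic P) :
    ∃ U : Ω → ℝ, IsUniformVariable P U := by
  classical
  obtain ⟨D, hmono, hD⟩ := hP.exists_monotone_family
  let Q := {q : ℚ // (q : ℝ) ∈ Set.Icc (0 : ℝ) 1}
  have : Nonempty Q := ⟨⟨0, by simp⟩⟩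
  -- The infimum over `q` is the least level at which `ω` enters the family `D`, capped at `1`.
  let f : Q → Ω → ℝ := fun q ω => if ω ∈ D (q.1 : ℝ) then (q.1 : ℝ) else 1
  have hf : ∀ q, Measurable (f q) := fun q =>
    Measurable.ite (hD _ q.2).1 measurable_const measurable_const
  have hbdd : ∀ ω, BddBelow (Set.range fun q => f q ω) := by
    refine fun ω => ⟨0, ?_⟩
    rintro _ ⟨q, rfl⟩
    dsimp only [f]
    split_ifs
    exacts [q.2.1, zero_le_one]
  let V : Ω → ℝ := fun ω => ⨅ q, f q ω
  have hV : Measurable V := Measurable.iInf hf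
  have hV1 : ∀ t : ℝ, t < 1 → ∀ s : ℚ, (s : ℝ) ∈ Set.Icc (0 : ℝ) 1 → t < s →
      {ω | V ω ≤ t} ⊆ D s := by
    intro t ht s hs hts ω hω
    obtain ⟨q, hq⟩ := exists_lt_of_ciInf_lt (lt_of_le_of_lt hω (lt_min hts ht))
    dsimp only [f] at hq
    split_ifs at hq with h
    · exact hmono (hq.trans_le (min_le_left _ _)).le h
    · exact absurd hq (not_lt.2 (min_le_right _ _))
  have hV2 : ∀ t : ℝ, ∀ s : ℚ, (s : ℝ) ∈ Set.Icc (0 : ℝ) 1 → (s : ℝ) ≤ t →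
      D s ⊆ {ω | V ω ≤ t} := by
    intro t s hs hst ω hω
    refine (ciInf_le (hbdd ω) ⟨s, hs⟩).trans ?_
    simpa [f, hω] using hst
  have hVge : ∀ t ∈ Set.Icc (0 : ℝ) 1, t ≤ P.real {ω | V ω ≤ t} := by
    intro t ht
    refine le_of_forall_rat_lt_imp_le fun s hs => ?_
    rcases lt_or_ge (s : ℝ) 0 with h | h
    · exact h.le.trans measureReal_nonneg
    · have hs' : (s : ℝ) ∈ Set.Icc (0 : ℝ) 1 := ⟨h, hs.le.trans ht.2⟩
      rw [← (hD s hs').2]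
      exact measureReal_mono (hV2 t s hs' hs.le)
  have hVeq : ∀ t ∈ Set.Icc (0 : ℝ) 1, P.real {ω | V ω ≤ t} = t := by
    refine fun t ht => le_antisymm ?_ (hVge t ht)
    rcases ht.2.eq_or_lt with rfl | h1
    · exact measureReal_le_one
    refine le_of_forall_lt_rat_imp_le fun s hs => ?_
    rcases le_or_gt (s : ℝ) 1 with h | h
    · have hs' : (s : ℝ) ∈ Set.Icc (0 : ℝ) 1 := ⟨ht.1.trans hs.le, h⟩
      rw [← (hD s hs').2]
      exact measureReal_mono (hV1 t h1 s hs' hs)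
    · exact measureReal_le_one.trans h.le
  have h0 : ∀ᵐ ω ∂P, 0 < V ω := by
    have := hVeq 0 (by simp)
    rw [measureReal_eq_zero_iff] at this
    rw [ae_iff]
    simpa using this
  have h1 : ∀ᵐ ω ∂P, V ω < 1 := by
    rw [ae_iff, ← measureReal_eq_zero_iff]
    refine le_antisymm (le_of_forall_pos_le_add fun ε hε => ?_) measureReal_nonneg
    have hε' : max 0 (1 - ε) ∈ Set.Icc (0 : ℝ) 1 := ⟨le_max_left _ _, by simp [hε.le]⟩
    have hlt : max 0 (1 - ε) < 1 := by simp [hε]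
    have h2 : {ω | ¬ V ω < 1} ⊆ {ω | V ω ≤ max 0 (1 - ε)}ᶜ := fun ω hω h3 =>
      hω (lt_of_le_of_lt h3 hlt)
    have h3 := measureReal_mono (μ := P) h2
    rw [probReal_compl_eq_one_sub (measurableSet_le hV measurable_const), hVeq _ hε'] at h3
    linarith [le_max_right 0 (1 - ε)]
  have hS : MeasurableSet {ω | V ω ∈ Set.Ioo (0 : ℝ) 1} := hV measurableSet_Ioo
  -- Moving the null set where `V` is `0` or `1` to `1 / 2` puts every value in the open interval,
  -- where `quantile_le_iff` applies.
  refine ⟨fun ω => if V ω ∈ Set.Ioo (0 : ℝ) 1 then V ω else 1 / 2,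
    Measurable.ite hS hV measurable_const, fun ω => ?_, fun t ht => ?_⟩
  · split_ifs with h
    · exact h
    · norm_num
  · refine (measureReal_congr ?_).trans (hVeq t ht)
    filter_upwards [h0, h1] with ω hω0 hω1
    have : V ω ∈ Set.Ioo (0 : ℝ) 1 := ⟨hω0, hω1⟩
    change ((if V ω ∈ Set.Ioo (0 : ℝ) 1 then V ω else 1 / 2) ≤ t) = (V ω ≤ t)
    rw [if_pos this]

/-! ### Quantile transforms and convergence in `L^p` -/

/-- Riesz–Scheffé: almost everywhere convergence together with convergence of the `p`-th absolute
moments implies convergence in `L^p`. -/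
theorem tendsto_eLpNorm_sub_of_tendsto_lintegral {Ω : Type*} [MeasurableSpace Ω] {P : Measure Ω}
    {p : ℝ≥0∞} (hp_one : 1 ≤ p) (hp_top : p ≠ ∞) {f : ℕ → Ω → ℝ} {g : Ω → ℝ}
    (hf : ∀ n, Measurable (f n)) (hg : Measurable g)
    (hfg : ∀ᵐ ω ∂P, Tendsto (fun n => f n ω) atTop (𝓝 (g ω)))
    (hgp : ∫⁻ ω, ‖g ω‖ₑ ^ p.toReal ∂P ≠ ∞)
    (hmom : Tendsto (fun n => ∫⁻ ω, ‖f n ω‖ₑ ^ p.toReal ∂P) atTop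
      (𝓝 (∫⁻ ω, ‖g ω‖ₑ ^ p.toReal ∂P))) :
    Tendsto (fun n => eLpNorm (fun ω => f n ω - g ω) p P) atTop (𝓝 0) := by
  have hp0 : p ≠ 0 := (zero_lt_one.trans_le hp_one).ne'
  set q := p.toReal with hq
  have hq1 : 1 ≤ q := by
    rw [hq, ← ENNReal.toReal_one]
    exact ENNReal.toReal_mono hp_top hp_one
  have hq0 : 0 < q := by linarith
  -- From `|a - b|^q ≤ 2^(q-1) (|a|^q + |b|^q)`: thus `G n - H n` is nonnegative, and Fatou's lemma
  -- for it forces `∫ H n → 0`.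
  set C : ℝ≥0∞ := 2 ^ (q - 1) with hC
  have hCtop : C ≠ ∞ := ENNReal.rpow_ne_top_of_nonneg (by linarith) (by simp)
  let G : ℕ → Ω → ℝ≥0∞ := fun n ω => C * (‖f n ω‖ₑ ^ q + ‖g ω‖ₑ ^ q)
  let H : ℕ → Ω → ℝ≥0∞ := fun n ω => ‖f n ω - g ω‖ₑ ^ q
  have hGm : ∀ n, Measurable (G n) := fun n => by
    have := hf n
    fun_prop
  have hHm : ∀ n, Measurable (H n) := fun n => by
    have := hf n
    fun_prop
  have hHG : ∀ n ω, H n ω ≤ G n ω := fun n ω =>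
    (ENNReal.rpow_le_rpow enorm_sub_le hq0.le).trans
      (ENNReal.rpow_add_le_mul_rpow_add_rpow _ _ hq1)
  set I := ∫⁻ ω, ‖g ω‖ₑ ^ q ∂P with hI
  have hGint : Tendsto (fun n => ∫⁻ ω, G n ω ∂P) atTop (𝓝 (C * (I + I))) := by
    have h : ∀ n, ∫⁻ ω, G n ω ∂P = C * (∫⁻ ω, ‖f n ω‖ₑ ^ q ∂P + I) := fun n => by
      have := hf n
      rw [lintegral_const_mul _ (by fun_prop), lintegral_add_right _ (by fun_prop)]
    simp_rw [h]
    exact ENNReal.Tendsto.const_mul (hmom.add tendsto_const_nhds) (Or.inr hCtop)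
  have hctop : C * (I + I) ≠ ∞ := by finiteness
  have hsum : ∀ n, ∫⁻ ω, (G n ω - H n ω) ∂P + ∫⁻ ω, H n ω ∂P = ∫⁻ ω, G n ω ∂P := fun n => by
    rw [← lintegral_add_right _ (hHm n)]
    exact lintegral_congr fun ω => tsub_add_cancel_of_le (hHG n ω)
  have hfatou : C * (I + I) ≤ liminf (fun n => ∫⁻ ω, (G n ω - H n ω) ∂P) atTop := by
    refine le_trans (le_of_eq ?_) (lintegral_liminf_le fun n => (hGm n).sub (hHm n))
    have h2 : C * (I + I) = ∫⁻ ω, C * (‖g ω‖ₑ ^ q + ‖g ω‖ₑ ^ q) ∂P := by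
      rw [lintegral_const_mul _ (by fun_prop), lintegral_add_right _ (by fun_prop)]
    rw [h2]
    refine lintegral_congr_ae ?_
    filter_upwards [hfg] with ω hω
    have h3 : Tendsto (fun n => G n ω) atTop (𝓝 (C * (‖g ω‖ₑ ^ q + ‖g ω‖ₑ ^ q))) := by
      refine ENNReal.Tendsto.const_mul (Tendsto.add ?_ tendsto_const_nhds) (Or.inr hCtop)
      exact (ENNReal.continuous_rpow_const.tendsto _).comp (hω.enorm)
    have h4 : Tendsto (fun n => H n ω) atTop (𝓝 0) := by
      have h5 : Tendsto (fun n => ‖f n ω - g ω‖ₑ) atTop (𝓝 0) := by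
        have := (hω.sub_const (g ω)).enorm
        simpa using this
      have := (ENNReal.continuous_rpow_const (y := q)).tendsto 0 |>.comp h5
      simpa [ENNReal.zero_rpow_of_pos hq0, Function.comp_def] using this
    have h5 := ENNReal.Tendsto.sub h3 h4 (Or.inr ENNReal.zero_ne_top)
    rw [tsub_zero] at h5
    exact h5.liminf_eq.symm
  have hH0 : Tendsto (fun n => ∫⁻ ω, H n ω ∂P) atTop (𝓝 0) := by
    rw [ENNReal.tendsto_nhds_zero]
    intro ε hε
    rcases eq_or_ne ε ∞ with rfl | hεtop
    · simp
    have hε2 : ε / 2 ≠ 0 := (ENNReal.half_pos hε.ne').ne'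
    rcases eq_or_ne (C * (I + I)) 0 with hc0 | hc0
    · filter_upwards [(ENNReal.tendsto_nhds_zero.1 (hc0 ▸ hGint)) ε hε] with n hn
      exact (lintegral_mono (hHG n)).trans hn
    · have h1 : C * (I + I) - ε / 2 < liminf (fun n => ∫⁻ ω, (G n ω - H n ω) ∂P) atTop :=
        (ENNReal.sub_lt_self hctop hc0 hε2).trans_le hfatou
      have h2 : ∀ᶠ n in atTop, ∫⁻ ω, G n ω ∂P < C * (I + I) + ε / 2 :=
        hGint.eventually_lt_const (ENNReal.lt_add_right hctop hε2)
      filter_upwards [eventually_lt_of_lt_liminf h1, h2] with n hn1 hn2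
      rw [← hsum n] at hn2
      have h3 : C * (I + I) ≤ ∫⁻ ω, (G n ω - H n ω) ∂P + ε / 2 := tsub_le_iff_right.1 hn1.le
      have hfin : ∫⁻ ω, (G n ω - H n ω) ∂P ≠ ∞ := ne_top_of_le_ne_top
        (hn2.trans_le le_top).ne le_self_add
      have h4 : ∫⁻ ω, (G n ω - H n ω) ∂P + ∫⁻ ω, H n ω ∂P ≤
          ∫⁻ ω, (G n ω - H n ω) ∂P + ε := by
        refine hn2.le.trans ((add_le_add_left h3 _).trans (le_of_eq ?_))
        rw [add_assoc, ENNReal.add_halves]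
      exact (ENNReal.add_le_add_iff_left hfin).1 h4
  simp_rw [eLpNorm_eq_lintegral_rpow_enorm_toReal hp0 hp_top]
  have := (ENNReal.continuous_rpow_const (y := 1 / q)).tendsto 0 |>.comp hH0
  simpa [ENNReal.zero_rpow_of_pos (inv_pos.2 hq0), Function.comp_def, H] using this

/-- The quantile function (generalized inverse of the distribution function) of a measure
on the real line. -/
noncomputable def quantile (ν : Measure ℝ) (u : ℝ) : ℝ := sInf {t | u ≤ cdf ν t}

/-- Right continuity of the distribution function makes the infimum attained; `u < 1` makes the set
nonempty and `0 < u` bounds it below. -/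
theorem quantile_le_iff (ν : Measure ℝ) {u t : ℝ} (hu : u ∈ Set.Ioo (0 : ℝ) 1) :
    quantile ν u ≤ t ↔ u ≤ cdf ν t := by
  have hne : {t | u ≤ cdf ν t}.Nonempty :=
    (((tendsto_cdf_atTop ν).eventually_const_lt hu.2).exists).imp fun _ h => h.le
  obtain ⟨b, hb⟩ := ((tendsto_cdf_atBot ν).eventually_lt_const hu.1).exists
  have hbdd : BddBelow {t | u ≤ cdf ν t} :=
    ⟨b, fun s hs => le_of_not_gt fun h => (hb.trans_le hs).not_ge (monotone_cdf ν h.le)⟩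
  refine ⟨fun h => ?_, fun h => csInf_le hbdd h⟩
  refine le_trans ?_ (monotone_cdf ν h)
  have hcont : Tendsto (cdf ν) (𝓝[>] (quantile ν u)) (𝓝 (cdf ν (quantile ν u))) :=
    ((cdf ν).right_continuous (quantile ν u)).mono_left
      (nhdsWithin_mono _ Set.Ioi_subset_Ici_self)
  refine ge_of_tendsto hcont ?_
  filter_upwards [self_mem_nhdsWithin] with s hs
  obtain ⟨r, hr, hrs⟩ := exists_lt_of_csInf_lt hne hs
  exact le_trans hr (monotone_cdf ν hrs.le)

theorem quantile_mono_of_cdf_le {ν ν' : Measure ℝ} (h : ∀ t, cdf ν' t ≤ cdf ν t) {u : ℝ}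
    (hu : u ∈ Set.Ioo (0 : ℝ) 1) : quantile ν u ≤ quantile ν' u :=
  (quantile_le_iff ν hu).2 (((quantile_le_iff ν' hu).1 le_rfl).trans (h _))

/-- Quantile functions converge off a countable set if the distribution functions converge at
the rationals. -/
theorem tendsto_quantile {ν : Measure ℝ} {νs : ℕ → Measure ℝ}
    (h : ∀ q : ℚ, Tendsto (fun n => cdf (νs n) q) atTop (𝓝 (cdf ν q))) {u : ℝ}
    (hu : u ∈ Set.Ioo (0 : ℝ) 1) (hu' : u ∉ Set.range fun q : ℚ => cdf ν q) :
    Tendsto (fun n => quantile (νs n) u) atTop (𝓝 (quantile ν u)) := by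
  refine tendsto_order.2 ⟨fun a ha => ?_, fun a ha => ?_⟩
  · obtain ⟨q, haq, hq⟩ := exists_rat_btwn ha
    rw [← not_le, quantile_le_iff ν hu, not_le] at hq
    filter_upwards [(h q).eventually_lt_const hq] with n hn
    rw [← not_le, ← quantile_le_iff (νs n) hu, not_le] at hn
    exact haq.trans hn
  · obtain ⟨q, hq, hqa⟩ := exists_rat_btwn ha
    -- `quantile ν u < q` gives only `u ≤ cdf ν q`; the excluded countable set makes this strict,
    -- hence stable under the limit.
    have h1 : u < cdf ν q :=
      lt_of_le_of_ne ((quantile_le_iff ν hu).1 hq.le) fun he => hu' ⟨q, he.symm⟩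
    filter_upwards [(h q).eventually_const_lt h1] with n hn
    exact ((quantile_le_iff (νs n) hu).2 hn.le).trans_lt hqa

namespace IsUniformVariable

variable {Ω : Type*} [MeasurableSpace Ω] {P : Measure Ω} {U : Ω → ℝ}

theorem measurable_quantile (hU : IsUniformVariable P U) (ν : Measure ℝ) :
    Measurable fun ω => quantile ν (U ω) := by
  refine measurable_of_Iic fun t => ?_
  have : (fun ω => quantile ν (U ω)) ⁻¹' Set.Iic t = {ω | U ω ≤ cdf ν t} := by
    ext ω
    exact quantile_le_iff ν (hU.mem_Ioo ω)
  rw [this]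
  exact measurableSet_le hU.measurable measurable_const

variable [IsProbabilityMeasure P]

theorem map_quantile (hU : IsUniformVariable P U) (ν : Measure ℝ) [IsProbabilityMeasure ν] :
    P.map (fun ω => quantile ν (U ω)) = ν := by
  have := Measure.isProbabilityMeasure_map (μ := P) (hU.measurable_quantile ν).aemeasurable
  refine Measure.eq_of_cdf _ _ (StieltjesFunction.ext fun t => ?_)
  rw [cdf_eq_real, map_measureReal_apply (hU.measurable_quantile ν) measurableSet_Iic]
  rw [← hU.measureReal_le _ ⟨cdf_nonneg ν t, cdf_le_one ν t⟩]
  congr 1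
  ext ω
  exact quantile_le_iff ν (hU.mem_Ioo ω)

theorem memLp_quantile (hU : IsUniformVariable P U) {ν : Measure ℝ} [IsProbabilityMeasure ν]
    {p : ℝ≥0∞} (hν : MemLp id p ν) : MemLp (fun ω => quantile ν (U ω)) p P := by
  rw [← hU.map_quantile ν] at hν
  exact (memLp_map_measure_iff (by fun_prop) (hU.measurable_quantile ν).aemeasurable).1 hν

/-- Used to discard the countable exceptional set of `tendsto_quantile`. -/
theorem ae_ne (hU : IsUniformVariable P U) (t : ℝ) : ∀ᵐ ω ∂P, U ω ≠ t := by
  by_cases ht : t ∈ Set.Ioo (0 : ℝ) 1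
  · rw [ae_iff, ← measureReal_eq_zero_iff]
    refine le_antisymm (le_of_forall_pos_le_add fun ε hε => ?_) measureReal_nonneg
    set s := max 0 (t - ε) with hs
    have hst : s < t := max_lt ht.1 (by linarith)
    have hs01 : s ∈ Set.Icc (0 : ℝ) 1 := ⟨le_max_left _ _, (hst.trans ht.2).le⟩
    have hms : MeasurableSet {ω | U ω ≤ s} := measurableSet_le hU.measurable measurable_const
    have hsub : {ω | ¬ U ω ≠ t} ⊆ {ω | U ω ≤ t} \ {ω | U ω ≤ s} := fun ω hω =>
      ⟨(not_not.1 hω).le, fun h => hst.not_ge ((not_not.1 hω).symm.le.trans h)⟩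
    have h1 := measureReal_mono (μ := P) hsub
    have hsub' : {ω | U ω ≤ s} ⊆ {ω | U ω ≤ t} := fun ω h => le_trans h hst.le
    rw [measureReal_sdiff hsub' hms,
      hU.measureReal_le t ⟨ht.1.le, ht.2.le⟩, hU.measureReal_le s hs01] at h1
    linarith [le_max_right 0 (t - ε)]
  · exact Eventually.of_forall fun ω h => ht (h ▸ hU.mem_Ioo ω)

/-- The quantile transforms converge in `L^p` if the distribution functions converge at the
rationals and the `p`-th absolute moments converge. -/
theorem tendsto_toLp_quantile (hU : IsUniformVariable P U) {p : ℝ≥0∞} [Fact (1 ≤ p)]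
    (hp_top : p ≠ ∞) {ν : Measure ℝ} [IsProbabilityMeasure ν] {νs : ℕ → Measure ℝ}
    [∀ n, IsProbabilityMeasure (νs n)] (hν : MemLp id p ν) (hνs : ∀ n, MemLp id p (νs n))
    (hcdf : ∀ q : ℚ, Tendsto (fun n => cdf (νs n) q) atTop (𝓝 (cdf ν q)))
    (hmom : Tendsto (fun n => ∫⁻ x, ‖x‖ₑ ^ p.toReal ∂(νs n)) atTop
      (𝓝 (∫⁻ x, ‖x‖ₑ ^ p.toReal ∂ν))) :
    Tendsto (fun n => (hU.memLp_quantile (hνs n)).toLp) atTop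
      (𝓝 (hU.memLp_quantile hν).toLp) := by
  have hp1 : 1 ≤ p := Fact.out
  have hp0 : p ≠ 0 := (zero_lt_one.trans_le hp1).ne'
  have hint : ∀ (μ : Measure ℝ) [IsProbabilityMeasure μ],
      ∫⁻ x, ‖x‖ₑ ^ p.toReal ∂μ = ∫⁻ ω, ‖quantile μ (U ω)‖ₑ ^ p.toReal ∂P := fun μ _ => by
    conv_lhs => rw [← hU.map_quantile μ]
    exact lintegral_map (by fun_prop) (hU.measurable_quantile μ)
  have hae : ∀ᵐ ω ∂P, Tendsto (fun n => quantile (νs n) (U ω)) atTop (𝓝 (quantile ν (U ω))) := by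
    have h : ∀ᵐ ω ∂P, ∀ q : ℚ, U ω ≠ cdf ν q := ae_all_iff.2 fun q => hU.ae_ne _
    filter_upwards [h] with ω hω
    refine tendsto_quantile hcdf (hU.mem_Ioo ω) ?_
    rintro ⟨q, hq⟩
    exact hω q hq.symm
  rw [Lp.tendsto_Lp_iff_tendsto_eLpNorm'']
  refine tendsto_eLpNorm_sub_of_tendsto_lintegral hp1 hp_top
    (fun n => hU.measurable_quantile (νs n)) (hU.measurable_quantile ν) hae ?_ ?_
  · exact (lintegral_rpow_enorm_lt_top_of_eLpNorm_lt_top hp0 hp_top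
      (hU.memLp_quantile hν).eLpNorm_lt_top).ne
  · simpa only [hint] using hmom

theorem hasDistributionFunction_quantile (hU : IsUniformVariable P U) {p : ℝ≥0∞} {ν : Measure ℝ}
    [IsProbabilityMeasure ν] (hν : MemLp id p ν) :
    HasDistributionFunction (hU.memLp_quantile hν).toLp (cdf ν) := by
  intro t
  rw [← hU.measureReal_le _ ⟨cdf_nonneg ν t, cdf_le_one ν t⟩]
  refine measureReal_congr ?_
  filter_upwards [(hU.memLp_quantile hν).coeFn_toLp] with ω hω
  change (((hU.memLp_quantile hν).toLp) ω ≤ t) = (U ω ≤ cdf ν t)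
  rw [hω, quantile_le_iff ν (hU.mem_Ioo ω)]

end IsUniformVariable

theorem hasDistributionFunction_toLp_cdf_map {Ω : Type*} [MeasurableSpace Ω] {P : Measure Ω}
    [IsProbabilityMeasure P] {p : ℝ≥0∞} {X : Ω → ℝ} (hX : Measurable X) (hXp : MemLp X p P) :
    HasDistributionFunction hXp.toLp (cdf (P.map X)) := by
  have := Measure.isProbabilityMeasure_map (μ := P) hX.aemeasurable
  intro t
  rw [cdf_eq_real, map_measureReal_apply hX measurableSet_Iic]
  refine measureReal_congr ?_
  filter_upwards [hXp.coeFn_toLp] with ω hω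
  change ((hXp.toLp) ω ≤ t) = (X ω ≤ t)
  rw [hω]

/-! ### Risk as a function of the distribution -/

section RiskMeasure

variable {Ω : Type*} [MeasurableSpace Ω] {P : Measure Ω} [IsProbabilityMeasure P] {p : ℝ≥0∞}
  {ρ : Lp ℝ p P → ℝ}

/-- Stochastic dominance becomes pointwise order once both laws are realised as quantile transforms
of the same uniform variable. -/
theorem IsConvexRiskMeasure.riskOfDistribution_mono (hρ : IsConvexRiskMeasure ρ)
    (hρ_law : IsLawInvariant ρ) (hP : ∃ U, IsUniformVariable P U) {ν ν' : Measure ℝ}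
    [IsProbabilityMeasure ν] [IsProbabilityMeasure ν'] (hν : MemLp id p ν) (hν' : MemLp id p ν')
    (h : ∀ t, cdf ν' t ≤ cdf ν t) :
    riskOfDistribution ρ (cdf ν) ≤ riskOfDistribution ρ (cdf ν') := by
  obtain ⟨U, hU⟩ := hP
  rw [riskOfDistribution_eq hρ_law (hU.hasDistributionFunction_quantile hν),
    riskOfDistribution_eq hρ_law (hU.hasDistributionFunction_quantile hν')]
  refine hρ.monotone _ _ ((Lp.coeFn_le _ _).1 ?_)
  filter_upwards [(hU.memLp_quantile hν).coeFn_toLp, (hU.memLp_quantile hν').coeFn_toLp]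
    with ω h1 h2
  rw [h1, h2]
  exact quantile_mono_of_cdf_le h (hU.mem_Ioo ω)

theorem IsConvexRiskMeasure.tendsto_riskOfDistribution [Fact (1 ≤ p)] (hp_top : p ≠ ∞)
    (hρ : IsConvexRiskMeasure ρ) (hρ_law : IsLawInvariant ρ) (hP : ∃ U, IsUniformVariable P U)
    {ν : Measure ℝ} [IsProbabilityMeasure ν] {νs : ℕ → Measure ℝ}
    [∀ n, IsProbabilityMeasure (νs n)] (hν : MemLp id p ν) (hνs : ∀ n, MemLp id p (νs n))
    (hcdf : ∀ q : ℚ, Tendsto (fun n => cdf (νs n) q) atTop (𝓝 (cdf ν q)))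
    (hmom : Tendsto (fun n => ∫⁻ x, ‖x‖ₑ ^ p.toReal ∂(νs n)) atTop
      (𝓝 (∫⁻ x, ‖x‖ₑ ^ p.toReal ∂ν))) :
    Tendsto (fun n => riskOfDistribution ρ (cdf (νs n))) atTop
      (𝓝 (riskOfDistribution ρ (cdf ν))) := by
  obtain ⟨U, hU⟩ := hP
  rw [riskOfDistribution_eq hρ_law (hU.hasDistributionFunction_quantile hν)]
  simp_rw [fun n => riskOfDistribution_eq hρ_law (hU.hasDistributionFunction_quantile (hνs n))]
  exact (hρ.continuous.tendsto _).comp (hU.tendsto_toLp_quantile hp_top hν hνs hcdf hmom)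

end RiskMeasure

/-! ### Empirical laws and strong consistency -/

/-- The empirical measure of the first `N` entries of the sample `x`. -/
noncomputable def empiricalMeasure (x : ℕ → ℝ) (N : ℕ) : Measure ℝ :=
  (N : ℝ≥0∞)⁻¹ • ∑ i ∈ Finset.range N, Measure.dirac (x i)

/-- The index is shifted because the empirical measure of an empty sample is zero. -/
instance (x : ℕ → ℝ) (N : ℕ) : IsProbabilityMeasure (empiricalMeasure x (N + 1)) := by
  constructor
  rw [empiricalMeasure, Measure.smul_apply, Measure.finsetSum_apply]
  simp only [measure_univ, Finset.sum_const, Finset.card_range, nsmul_eq_mul, mul_one, smul_eq_mul]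
  exact ENNReal.inv_mul_cancel (by simp) (ENNReal.natCast_ne_top _)

theorem cdf_empiricalMeasure (x : ℕ → ℝ) (N : ℕ) :
    ⇑(cdf (empiricalMeasure x (N + 1))) = empiricalCDF x (N + 1) := by
  classical
  ext t
  rw [cdf_eq_real, measureReal_def, empiricalMeasure, Measure.smul_apply, Measure.finsetSum_apply,
    empiricalCDF, smul_eq_mul, ENNReal.toReal_mul, ENNReal.toReal_inv, ENNReal.toReal_natCast,
    div_eq_inv_mul]
  congr 1
  simp only [Measure.dirac_apply' _ measurableSet_Iic, Set.indicator_apply, Set.mem_Iic,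
    Pi.one_apply, Finset.sum_boole, ENNReal.toReal_natCast]

theorem lintegral_empiricalMeasure (x : ℕ → ℝ) (N : ℕ) (f : ℝ → ℝ≥0∞) :
    ∫⁻ t, f t ∂(empiricalMeasure x N) = (N : ℝ≥0∞)⁻¹ * ∑ i ∈ Finset.range N, f (x i) := by
  rw [empiricalMeasure, lintegral_smul_measure, lintegral_finsetSum_measure]
  simp [lintegral_dirac]

theorem memLp_id_empiricalMeasure (x : ℕ → ℝ) (N : ℕ) {p : ℝ≥0∞} (hp0 : p ≠ 0)
    (hp_top : p ≠ ∞) : MemLp id p (empiricalMeasure x (N + 1)) := by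
  refine ⟨by fun_prop, ?_⟩
  rw [eLpNorm_lt_top_iff_lintegral_rpow_enorm_lt_top hp0 hp_top, lintegral_empiricalMeasure]
  refine ENNReal.mul_lt_top (by simp) (ENNReal.sum_lt_top.2 fun i _ => ?_)
  exact ENNReal.rpow_lt_top_of_nonneg ENNReal.toReal_nonneg enorm_ne_top

section Sampling

variable {Ω Θ : Type*} [MeasurableSpace Ω] {P : Measure Ω}
  [MeasurableSpace Θ] {ζ : Ω → Θ} {ζs : ℕ → Ω → Θ}

/-- The strong law of large numbers for a function of an i.i.d. sample. -/
theorem ae_tendsto_average_comp (hindep : iIndepFun ζs P)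
    (hident : ∀ i, IdentDistrib (ζs i) ζ P P) {g : Θ → ℝ} (hg : Measurable g)
    (hint : Integrable (fun ω => g (ζ ω)) P) :
    ∀ᵐ ω ∂P, Tendsto (fun n : ℕ => (∑ i ∈ Finset.range n, g (ζs i ω)) / n) atTop
      (𝓝 (∫ ω, g (ζ ω) ∂P)) := by
  have hid : ∀ i, IdentDistrib (fun ω => g (ζs i ω)) (fun ω => g (ζ ω)) P P := fun i =>
    (hident i).comp hg
  have h := strong_law_ae_real (μ := P) (fun i ω => g (ζs i ω)) ((hid 0).integrable_iff.2 hint)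
    (fun i j hij => (hindep.indepFun hij).comp hg hg) (fun i => (hid i).trans (hid 0).symm)
  rwa [(hid 0).integral_eq] at h

/-- The law of large numbers for `‖V‖ ^ p`. -/
theorem ae_tendsto_lintegral_empiricalMeasure (hindep : iIndepFun ζs P)
    (hident : ∀ i, IdentDistrib (ζs i) ζ P P) {V : Θ → ℝ} (hV : Measurable V)
    {p : ℝ≥0∞} (hp0 : p ≠ 0) (hp_top : p ≠ ∞) (hζ : Measurable ζ)
    (hVp : MemLp (fun ω => V (ζ ω)) p P) :
    ∀ᵐ ω ∂P, Tendsto (fun n : ℕ =>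
      ∫⁻ x, ‖x‖ₑ ^ p.toReal ∂(empiricalMeasure (fun i => V (ζs i ω)) (n + 1))) atTop
      (𝓝 (∫⁻ x, ‖x‖ₑ ^ p.toReal ∂(P.map fun ω => V (ζ ω)))) := by
  have henorm : ∀ x : ℝ, ‖x‖ₑ ^ p.toReal = ENNReal.ofReal (‖x‖ ^ p.toReal) := fun x => by
    rw [← ofReal_norm, ENNReal.ofReal_rpow_of_nonneg (norm_nonneg _)
      ENNReal.toReal_nonneg]
  have hint : Integrable (fun ω => ‖V (ζ ω)‖ ^ p.toReal) P := hVp.integrable_norm_rpow hp0 hp_top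
  have h := ae_tendsto_average_comp hindep hident (g := fun θ => ‖V θ‖ ^ p.toReal)
    (by fun_prop) hint
  filter_upwards [h] with ω hω
  have hlim : ∫⁻ x, ‖x‖ₑ ^ p.toReal ∂(P.map fun ω => V (ζ ω)) =
      ENNReal.ofReal (∫ ω, ‖V (ζ ω)‖ ^ p.toReal ∂P) := by
    have hVζ : Measurable fun ω => V (ζ ω) := hV.comp hζ
    rw [lintegral_map (by fun_prop) hVζ,
      ofReal_integral_eq_lintegral_ofReal hint (Eventually.of_forall fun ω => by positivity)]
    simp_rw [henorm]
  rw [hlim]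
  refine Tendsto.congr (fun n => ?_)
    ((ENNReal.continuous_ofReal.tendsto _).comp ((tendsto_add_atTop_iff_nat 1).2 hω))
  rw [lintegral_empiricalMeasure, Function.comp_apply, div_eq_inv_mul,
    ENNReal.ofReal_mul (by positivity), ENNReal.ofReal_inv_of_pos (by positivity),
    ENNReal.ofReal_natCast, ENNReal.ofReal_sum_of_nonneg fun i _ => by positivity]
  simp_rw [henorm]

variable [IsProbabilityMeasure P]

/-- The law of large numbers for the indicator of `{V ≤ t}`. -/
theorem ae_tendsto_empiricalCDF (hindep : iIndepFun ζs P)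
    (hident : ∀ i, IdentDistrib (ζs i) ζ P P) {V : Θ → ℝ} (hV : Measurable V)
    (hζ : Measurable ζ) (t : ℝ) :
    ∀ᵐ ω ∂P, Tendsto (fun n : ℕ => empiricalCDF (fun i => V (ζs i ω)) n t) atTop
      (𝓝 (cdf (P.map fun ω => V (ζ ω)) t)) := by
  classical
  have hVζ : Measurable fun ω => V (ζ ω) := hV.comp hζ
  have := Measure.isProbabilityMeasure_map (μ := P) hVζ.aemeasurable
  have hS : MeasurableSet {θ | V θ ≤ t} := measurableSet_le hV measurable_const
  have hS' : MeasurableSet {ω | V (ζ ω) ≤ t} := measurableSet_le hVζ measurable_const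
  have hg : (fun ω => Set.indicator {θ | V θ ≤ t} (1 : Θ → ℝ) (ζ ω)) =
      Set.indicator {ω | V (ζ ω) ≤ t} 1 := rfl
  have h := ae_tendsto_average_comp hindep hident (measurable_one.indicator hS)
    (by rw [hg]; exact (integrable_const (1 : ℝ)).indicator hS')
  filter_upwards [h] with ω hω
  rw [hg, integral_indicator_one hS'] at hω
  have h2 : cdf (P.map fun ω => V (ζ ω)) t = P.real {ω | V (ζ ω) ≤ t} := by
    rw [cdf_eq_real, map_measureReal_apply hVζ measurableSet_Iic]
    rfl
  rw [h2]
  refine hω.congr fun n => ?_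
  simp [empiricalCDF, Set.indicator_apply]

variable {p : ℝ≥0∞} [Fact (1 ≤ p)] {ρ : Lp ℝ p P → ℝ}

/-- Strong consistency: the risk of the empirical distribution converges almost surely to the
risk of the sampled random variable. -/
theorem IsConvexRiskMeasure.ae_tendsto_riskOfDistribution_empiricalCDF (hp_top : p ≠ ∞)
    (hρ : IsConvexRiskMeasure ρ) (hρ_law : IsLawInvariant ρ) (hP : ∃ U, IsUniformVariable P U)
    (hindep : iIndepFun ζs P) (hident : ∀ i, IdentDistrib (ζs i) ζ P P) (hζ : Measurable ζ)
    {V : Θ → ℝ} (hV : Measurable V) (hVp : MemLp (fun ω => V (ζ ω)) p P) :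
    ∀ᵐ ω ∂P, Tendsto
      (fun N : ℕ => riskOfDistribution ρ (empiricalCDF (fun i => V (ζs i ω)) N)) atTop
      (𝓝 (ρ hVp.toLp)) := by
  have hp0 : p ≠ 0 := (zero_lt_one.trans_le (Fact.out : 1 ≤ p)).ne'
  have hVζ : Measurable fun ω => V (ζ ω) := hV.comp hζ
  have := Measure.isProbabilityMeasure_map (μ := P) hVζ.aemeasurable
  have hcdf := ae_all_iff.2 fun q : ℚ => ae_tendsto_empiricalCDF hindep hident hV hζ q
  filter_upwards [hcdf, ae_tendsto_lintegral_empiricalMeasure hindep hident hV hp0 hp_top hζ hVp]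
    with ω h1 h2
  have h := hρ.tendsto_riskOfDistribution hp_top hρ_law hP
    ((memLp_map_measure_iff (by fun_prop) hVζ.aemeasurable).2 hVp)
    (fun n => memLp_id_empiricalMeasure (fun i => V (ζs i ω)) n hp0 hp_top)
    (fun q => by
      simp_rw [cdf_empiricalMeasure]
      exact (tendsto_add_atTop_iff_nat 1).2 (h1 q)) h2
  rw [riskOfDistribution_eq hρ_law (hasDistributionFunction_toLp_cdf_map hVζ hVp)] at h
  simp_rw [cdf_empiricalMeasure] at h
  exact (tendsto_add_atTop_iff_nat 1).1 h

theorem IsConvexRiskMeasure.riskOfDistribution_empiricalCDF_mono (hp_top : p ≠ ∞)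
    (hρ : IsConvexRiskMeasure ρ) (hρ_law : IsLawInvariant ρ) (hP : ∃ U, IsUniformVariable P U)
    {x y : ℕ → ℝ} (hxy : ∀ i, x i ≤ y i) (N : ℕ) :
    riskOfDistribution ρ (empiricalCDF x (N + 1)) ≤
      riskOfDistribution ρ (empiricalCDF y (N + 1)) := by
  have hp0 : p ≠ 0 := (zero_lt_one.trans_le (Fact.out : 1 ≤ p)).ne'
  rw [← cdf_empiricalMeasure, ← cdf_empiricalMeasure]
  refine hρ.riskOfDistribution_mono hρ_law hP (memLp_id_empiricalMeasure x N hp0 hp_top)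
    (memLp_id_empiricalMeasure y N hp0 hp_top) fun t => ?_
  rw [cdf_empiricalMeasure, cdf_empiricalMeasure, empiricalCDF, empiricalCDF]
  gcongr
  exact hxy _

end Sampling

/-! ### Analytic sets and measurable projection -/

/-- Analytic sets are inner regular for compact sets (Choquet's capacitability theorem for
finite measures). -/
theorem MeasureTheory.AnalyticSet.exists_isCompact_subset_le_measure {X : Type*}
    [TopologicalSpace X] [MeasurableSpace X] {μ : Measure X}
    [μ.OuterRegular] {A : Set X} (hA : AnalyticSet A) {c : ℝ≥0∞} (hc : c < μ A) :
    ∃ L ⊆ A, IsCompact L ∧ c ≤ μ L := by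
  rw [AnalyticSet] at hA
  rcases hA with rfl | ⟨f, hf, rfl⟩
  · simp at hc
  -- Coordinates in Baire space are bounded one at a time, keeping the measure of the image above
  -- `c`; continuity from below holds even for nonmeasurable increasing sets.
  let S := {C : Set (ℕ → ℕ) // c < μ (f '' C)}
  have hstep : ∀ (C : S) (k : ℕ), ∃ m : ℕ, c < μ (f '' (C.1 ∩ {x | x k ≤ m})) := by
    intro C k
    have hmono : Monotone fun m : ℕ => f '' (C.1 ∩ {x | x k ≤ m}) := fun m m' hm =>
      Set.image_mono fun x hx => ⟨hx.1, le_trans hx.2 hm⟩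
    have hU : f '' C.1 = ⋃ m : ℕ, f '' (C.1 ∩ {x | x k ≤ m}) := by
      rw [← Set.image_iUnion, ← Set.inter_iUnion]
      congr 1
      refine (Set.inter_eq_left.2 fun x _ => ?_).symm
      exact Set.mem_iUnion.2 ⟨x k, le_refl (x k)⟩
    have h := C.2
    rw [hU, hmono.measure_iUnion] at h
    exact lt_iSup_iff.1 h
  choose m hm using hstep
  let C : ℕ → S := fun k =>
    Nat.rec ⟨Set.univ, by rwa [Set.image_univ]⟩ (fun k C => ⟨_, hm C k⟩) k
  let n : ℕ → ℕ := fun k => m (C k) k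
  have hCsucc : ∀ k, (C (k + 1)).1 = (C k).1 ∩ {x | x k ≤ n k} := fun k => rfl
  have hCmem : ∀ k x, x ∈ (C k).1 → ∀ i < k, x i ≤ n i := by
    intro k
    induction k with
    | zero => intro x _ i hi; exact absurd hi (Nat.not_lt_zero i)
    | succ k ih =>
      intro x hx i hi
      rw [hCsucc] at hx
      rcases Nat.lt_succ_iff_lt_or_eq.1 hi with hi | rfl
      · exact ih x hx.1 i hi
      · exact hx.2
  let K : Set (ℕ → ℕ) := Set.univ.pi fun i => Set.Iic (n i)
  have hK : IsCompact K := isCompact_univ_pi fun i => (Set.finite_Iic (n i)).isCompact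
  refine ⟨f '' K, Set.image_subset_range f K, hK.image hf, ?_⟩
  rw [Set.measure_eq_iInf_isOpen]
  refine le_iInf₂ fun O hKO => le_iInf fun hO => ?_
  suffices h : ∃ k, (C k).1 ⊆ f ⁻¹' O by
    obtain ⟨k, hk⟩ := h
    exact (C k).2.le.trans (measure_mono (Set.image_subset_iff.2 hk))
  by_contra! hcon
  -- Truncating `x k` into the compact `K` gives a convergent subsequence. As `x k` already obeys
  -- the first `k` bounds, each coordinate is eventually untouched, so the `x k` have the same
  -- limit.
  choose x hxC hxO using fun k => Set.not_subset.1 (hcon k)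
  obtain ⟨y, hyK, φ, hφ, hy⟩ := hK.tendsto_subseq (x := fun k i => min (x k i) (n i))
    fun k i _ => Set.mem_Iic.2 (min_le_right _ _)
  have hx : Tendsto (x ∘ φ) atTop (𝓝 y) := by
    refine tendsto_pi_nhds.2 fun i => ((tendsto_pi_nhds.1 hy) i).congr' ?_
    filter_upwards [hφ.tendsto_atTop.eventually_gt_atTop i] with k hk
    exact min_eq_left (hCmem _ _ (hxC (φ k)) i hk)
  have hyO : y ∈ (f ⁻¹' O)ᶜ := (hO.preimage hf).isClosed_compl.mem_of_tendsto hx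
    (Eventually.of_forall fun k => hxO (φ k))
  exact hyO (hKO (Set.mem_image_of_mem f hyK))

/-- Analytic sets are universally measurable. -/
theorem MeasureTheory.AnalyticSet.nullMeasurableSet {X : Type*} [TopologicalSpace X] [T2Space X]
    [MeasurableSpace X] [OpensMeasurableSpace X] {μ : Measure X} [IsFiniteMeasure μ]
    [μ.OuterRegular] {A : Set X} (hA : AnalyticSet A) : NullMeasurableSet A μ := by
  by_cases h0 : μ A = 0
  · exact NullMeasurableSet.of_null h0
  obtain ⟨c, -, hc, hlim⟩ := exists_seq_strictMono_tendsto' (pos_iff_ne_zero.2 h0)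
  choose L hLA hLc hL using fun k => hA.exists_isCompact_subset_le_measure (hc k).2
  have hm : MeasurableSet (⋃ k, L k) := MeasurableSet.iUnion fun k => (hLc k).measurableSet
  have hle : μ A ≤ μ (⋃ k, L k) :=
    le_of_tendsto' hlim fun k => (hL k).trans (measure_mono (Set.subset_iUnion L k))
  exact hm.nullMeasurableSet.congr
    (ae_eq_of_subset_of_measure_ge (Set.iUnion_subset hLA) hle hm.nullMeasurableSet
      (measure_ne_top μ A))

/-- A measurable subset of a product only depends on countably many events in the second
factor. -/
theorem exists_measurable_eq_preimage_prodMap {Y Θ : Type*} [MeasurableSpace Y]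
    [MeasurableSpace Θ] {S : Set (Y × Θ)} (hS : MeasurableSet S) :
    ∃ g : Θ → ℕ → ℕ, Measurable g ∧ ∃ T : Set (Y × (ℕ → ℕ)), MeasurableSet T ∧
      S = Prod.map id g ⁻¹' T := by
  classical
  rw [← generateFrom_prod] at hS
  induction S, hS using MeasurableSpace.generateFrom_induction with
  | hC S hS _ =>
    obtain ⟨s, hs, t, ht, rfl⟩ := hS
    refine ⟨fun θ _ => if θ ∈ t then 1 else 0, measurable_pi_lambda _ fun _ => ?_,
      s ×ˢ {c | c 0 = 1}, hs.prod ?_, ?_⟩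
    · exact Measurable.ite ht measurable_const measurable_const
    · exact measurableSet_eq_fun (measurable_pi_apply 0) measurable_const
    · ext ⟨y, θ⟩
      simp
  | empty => exact ⟨fun _ _ => 0, measurable_const, ∅, MeasurableSet.empty, by simp⟩
  | compl S _ ih =>
    obtain ⟨g, hg, T, hT, rfl⟩ := ih
    exact ⟨g, hg, Tᶜ, hT.compl, rfl⟩
  | iUnion S _ ih =>
    choose g hg T hT hST using ih
    -- Countably many codes are merged into one by the pairing function on `ℕ`.
    refine ⟨fun θ k => g k.unpair.1 θ k.unpair.2, measurable_pi_lambda _ fun k =>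
      (measurable_pi_apply _).comp (hg _),
      ⋃ n, (Prod.map id fun c m => c (Nat.pair n m)) ⁻¹' T n, MeasurableSet.iUnion fun n => ?_, ?_⟩
    · exact (measurable_id.prodMap (measurable_pi_lambda _ fun m => measurable_pi_apply _)) (hT n)
    · ext ⟨y, θ⟩
      simp [hST]

/-- Measurable projection theorem. -/
theorem nullMeasurableSet_image_snd {Y Θ : Type*} [TopologicalSpace Y] [PolishSpace Y]
    [MeasurableSpace Y] [BorelSpace Y] [MeasurableSpace Θ] {μ : Measure Θ} [IsFiniteMeasure μ]
    {S : Set (Y × Θ)} (hS : MeasurableSet S) : NullMeasurableSet (Prod.snd '' S) μ := by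
  -- Since `Θ` carries no topology, the code `g` moves the problem to the Polish space `Y × (ℕ →
  -- ℕ)`, where projections of Borel sets are analytic.
  obtain ⟨g, hg, T, hT, rfl⟩ := exists_measurable_eq_preimage_prodMap hS
  have h : Prod.snd '' (Prod.map id g ⁻¹' T) = g ⁻¹' (Prod.snd '' T) := by
    ext θ
    simp
  rw [h]
  have hT' : AnalyticSet (Prod.snd '' T) := hT.analyticSet.image_of_continuous continuous_snd
  have hgT : NullMeasurableSet (Prod.snd '' T) (μ.map g) := by
    let := TopologicalSpace.upgradeIsCompletelyMetrizable (ℕ → ℕ)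
    exact hT'.nullMeasurableSet
  exact hgT.preimage (hg.quasiMeasurePreserving μ)

/-- The infimum over a Borel set of a jointly measurable function is almost everywhere
measurable. -/
theorem aemeasurable_biInf {Y Θ : Type*} [TopologicalSpace Y] [PolishSpace Y]
    [MeasurableSpace Y] [BorelSpace Y] [MeasurableSpace Θ] {μ : Measure Θ} [IsFiniteMeasure μ]
    {Ψ : Y → Θ → ℝ} (hΨ : Measurable (Function.uncurry Ψ)) {U : Set Y} (hU : MeasurableSet U) :
    AEMeasurable (fun θ => ⨅ y ∈ U, (Ψ y θ : EReal)) μ := by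
  have h : NullMeasurable (fun θ => ⨅ y ∈ U, (Ψ y θ : EReal)) μ := by
    refine measurable_of_Iio (δ := NullMeasurableSpace Θ μ) fun a => ?_
    have h1 : (fun θ => ⨅ y ∈ U, (Ψ y θ : EReal)) ⁻¹' Set.Iio a =
        Prod.snd '' {z : Y × Θ | z.1 ∈ U ∧ (Ψ z.1 z.2 : EReal) < a} := by
      ext θ
      simp [iInf_lt_iff]
    refine (congrArg (MeasurableSet (α := NullMeasurableSpace Θ μ)) h1).mpr ?_
    exact nullMeasurableSet_image_snd (μ := μ) ((measurable_fst hU).inter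
      (measurableSet_lt (measurable_coe_real_ereal.comp hΨ) measurable_const))
  exact h.aemeasurable

/-- A measurable real version of the infimum of `Ψ` over a neighbourhood on which `Ψ` has a lower
bound in `L^p`. -/
theorem exists_measurable_biInf {Ω Y Θ : Type*} [MeasurableSpace Ω] {P : Measure Ω}
    [IsFiniteMeasure P] [TopologicalSpace Y] [PolishSpace Y] [MeasurableSpace Y] [BorelSpace Y]
    [MeasurableSpace Θ] {Ψ : Y → Θ → ℝ} (hΨ : Measurable (Function.uncurry Ψ))
    {ζ : Ω → Θ} (hζ : Measurable ζ) {p : ℝ≥0∞} {U : Set Y} (hU : MeasurableSet U) {y₀ : Y}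
    (hy₀ : y₀ ∈ U) (hy₀p : MemLp (fun ω => Ψ y₀ (ζ ω)) p P) {h : Ω → ℝ} (hh : MemLp h p P)
    (hle : ∀ᵐ ω ∂P, ∀ y ∈ U, h ω ≤ Ψ y (ζ ω)) :
    ∃ V : Θ → ℝ, Measurable V ∧ MemLp (fun ω => V (ζ ω)) p P ∧
      ∀ᵐ θ ∂(P.map ζ), (V θ : EReal) = ⨅ y ∈ U, (Ψ y θ : EReal) := by
  have hI : AEMeasurable (fun θ => ⨅ y ∈ U, (Ψ y θ : EReal)) (P.map ζ) := aemeasurable_biInf hΨ hU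
  set J := hI.mk _ with hJ
  have hJm : Measurable J := hI.measurable_mk
  have hJI : ∀ᵐ ω ∂P, ⨅ y ∈ U, (Ψ y (ζ ω) : EReal) = J (ζ ω) :=
    ae_of_ae_map hζ.aemeasurable hI.ae_eq_mk
  -- The bound `h` excludes `⊥` and the value at `y₀` excludes `⊤`, so almost everywhere `toReal`
  -- loses nothing.
  have hbot : ∀ᵐ θ ∂(P.map ζ), J θ ≠ ⊥ := by
    refine (ae_map_iff hζ.aemeasurable (hJm (measurableSet_singleton ⊥).compl)).2 ?_
    change ∀ᵐ ω ∂P, J (ζ ω) ≠ ⊥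
    filter_upwards [hJI, hle] with ω h1 h2
    rw [← h1]
    refine ne_bot_of_le_ne_bot (EReal.coe_ne_bot (h ω)) (le_iInf₂ fun y hy => ?_)
    exact EReal.coe_le_coe_iff.2 (h2 y hy)
  have hV : ∀ᵐ θ ∂(P.map ζ), ((J θ).toReal : EReal) = ⨅ y ∈ U, (Ψ y θ : EReal) := by
    filter_upwards [hI.ae_eq_mk, hbot] with θ h1 h2
    rw [h1]
    refine EReal.coe_toReal ?_ h2
    rw [hJ, ← h1]
    exact ne_top_of_le_ne_top (EReal.coe_ne_top (Ψ y₀ θ)) (iInf₂_le y₀ hy₀)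
  refine ⟨fun θ => (J θ).toReal, hJm.ereal_toReal, ?_, hV⟩
  refine MemLp.mono (hh.norm.add hy₀p.norm)
    (hJm.ereal_toReal.comp hζ).aestronglyMeasurable ?_
  filter_upwards [ae_of_ae_map hζ.aemeasurable hV, hle] with ω h1 h2
  have h3 : h ω ≤ (J (ζ ω)).toReal := by
    rw [← EReal.coe_le_coe_iff, h1]
    exact le_iInf₂ fun y hy => EReal.coe_le_coe_iff.2 (h2 y hy)
  have h4 : (J (ζ ω)).toReal ≤ Ψ y₀ (ζ ω) := by
    rw [← EReal.coe_le_coe_iff, h1]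
    exact iInf₂_le y₀ hy₀
  simp only [Pi.add_apply, Real.norm_eq_abs]
  rw [abs_of_nonneg (add_nonneg (abs_nonneg (h ω)) (abs_nonneg (Ψ y₀ (ζ ω)))), abs_le]
  constructor
  · linarith [neg_abs_le (h ω), abs_nonneg (Ψ y₀ (ζ ω))]
  · linarith [le_abs_self (Ψ y₀ (ζ ω)), abs_nonneg (h ω)]

/-- Dominated convergence in `L^p`. -/
theorem tendsto_toLp_of_dominated {Ω : Type*} [MeasurableSpace Ω] {P : Measure Ω} {p : ℝ≥0∞}
    [Fact (1 ≤ p)] (hp_top : p ≠ ∞) {f : ℕ → Ω → ℝ} {g G : Ω → ℝ} (hf : ∀ n, Measurable (f n))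
    (hg : Measurable g) (hfp : ∀ n, MemLp (f n) p P) (hgp : MemLp g p P) (hG : MemLp G p P)
    (hbound : ∀ n, ∀ᵐ ω ∂P, ‖f n ω‖ ≤ G ω)
    (hfg : ∀ᵐ ω ∂P, Tendsto (fun n => f n ω) atTop (𝓝 (g ω))) :
    Tendsto (fun n => (hfp n).toLp) atTop (𝓝 hgp.toLp) := by
  have hp1 : 1 ≤ p := Fact.out
  have hp0 : p ≠ 0 := (zero_lt_one.trans_le hp1).ne'
  rw [Lp.tendsto_Lp_iff_tendsto_eLpNorm'']
  refine tendsto_eLpNorm_sub_of_tendsto_lintegral hp1 hp_top hf hg hfg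
    (lintegral_rpow_enorm_lt_top_of_eLpNorm_lt_top hp0 hp_top hgp.eLpNorm_lt_top).ne ?_
  refine tendsto_lintegral_of_dominated_convergence (fun ω => ‖G ω‖ₑ ^ p.toReal)
    (fun n => by have := hf n; fun_prop) (fun n => ?_)
    (lintegral_rpow_enorm_lt_top_of_eLpNorm_lt_top hp0 hp_top hG.eLpNorm_lt_top).ne ?_
  · filter_upwards [hbound n] with ω hω
    refine ENNReal.rpow_le_rpow (enorm_le_iff_norm_le.2 ?_) ENNReal.toReal_nonneg
    exact hω.trans (le_abs_self _)
  · filter_upwards [hfg] with ω hω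
    exact (ENNReal.continuous_rpow_const.tendsto _).comp hω.enorm

/-! ### Recovery sequences -/

/-- A real function on a second countable space is approximated along its graph by its values on
a countable set. -/
theorem exists_countable_dense_graph {X : Type*} [TopologicalSpace X] [SecondCountableTopology X]
    (φ : X → ℝ) :
    ∃ D : Set X, D.Countable ∧ ∀ x, ∃ d : ℕ → X, (∀ n, d n ∈ D) ∧ Tendsto d atTop (𝓝 x) ∧
      Tendsto (fun n => φ (d n)) atTop (𝓝 (φ x)) := by
  -- Density in the graph controls the values of `φ` too, without continuity of `φ`.
  let S := Set.range fun x => (x, φ x)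
  obtain ⟨D', hD'c, hD'⟩ := TopologicalSpace.exists_countable_dense S
  refine ⟨(fun s : S => s.1.1) '' D', hD'c.image _, fun x => ?_⟩
  obtain ⟨s, hsD, hs⟩ := mem_closure_iff_seq_limit.1 (hD' ⟨(x, φ x), x, rfl⟩)
  have hs' : Tendsto (fun n => (s n).1) atTop (𝓝 (x, φ x)) :=
    (continuous_subtype_val.tendsto _).comp hs
  refine ⟨fun n => (s n).1.1, fun n => ⟨s n, hsD n, rfl⟩, (continuous_fst.tendsto _).comp hs', ?_⟩
  have h2 : ∀ n, φ (s n).1.1 = (s n).1.2 := fun n => by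
    obtain ⟨y, hy⟩ := (s n).2
    rw [← hy]
  simp_rw [h2]
  exact (continuous_snd.tendsto _).comp hs'

/-- Diagonal construction of recovery sequences from pointwise convergence along an
approximating sequence. -/
theorem exists_recovery_sequence {X : Type*} [TopologicalSpace X] {φs : ℕ → X → ℝ} {φ : X → ℝ}
    {x : X} {d : ℕ → X} (hd : Tendsto d atTop (𝓝 x))
    (hφd : Tendsto (fun n => φ (d n)) atTop (𝓝 (φ x)))
    (hφs : ∀ k, Tendsto (fun N => φs N (d k)) atTop (𝓝 (φ (d k)))) :
    ∃ u : ℕ → X, Tendsto u atTop (𝓝 x) ∧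
      limsup (fun N => (φs N (u N) : EReal)) atTop ≤ (φ x : EReal) := by
  have hM : ∀ k : ℕ, ∃ M, ∀ N ≥ M, φs N (d k) < φ (d k) + 1 / ((k : ℝ) + 1) := fun k =>
    eventually_atTop.1 ((hφs k).eventually_lt_const (lt_add_of_pos_right _ (by positivity)))
  choose M hM using hM
  -- The largest stage up to `N` whose threshold has been passed; this is genuine once `M 0 ≤ N`, as
  -- `0` is also the default value.
  let k : ℕ → ℕ := fun N => Nat.findGreatest (fun k => M k ≤ N) N
  have hk : Tendsto k atTop atTop := by
    refine tendsto_atTop.2 fun K => ?_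
    filter_upwards [eventually_ge_atTop (max K (M K))] with N hN
    exact Nat.le_findGreatest ((le_max_left _ _).trans hN) ((le_max_right _ _).trans hN)
  refine ⟨fun N => d (k N), hd.comp hk, ?_⟩
  have hle : ∀ᶠ N in atTop, (φs N (d (k N)) : EReal) ≤
      ((φ (d (k N)) + 1 / ((k N : ℝ) + 1) : ℝ) : EReal) := by
    filter_upwards [eventually_ge_atTop (M 0)] with N hN
    have h : M (k N) ≤ N :=
      Nat.findGreatest_spec (P := fun k => M k ≤ N) (Nat.zero_le N) hN
    exact EReal.coe_le_coe_iff.2 (hM _ _ h).le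
  refine (limsup_le_limsup hle).trans (le_of_eq (Tendsto.limsup_eq ?_))
  refine (continuous_coe_real_ereal.tendsto _).comp ?_
  simpa using (hφd.comp hk).add (tendsto_one_div_add_atTop_nhds_zero_nat.comp hk)

/-! ### The liminf inequality -/

section Consistency

variable {Ω Θ Y : Type*} [MeasurableSpace Ω] {P : Measure Ω}
  [MeasurableSpace Θ] {ζ : Ω → Θ} {ζs : ℕ → Ω → Θ} {p : ℝ≥0∞} [Fact (1 ≤ p)]
  [TopologicalSpace Y] [MeasurableSpace Y] [BorelSpace Y] {Ψ : Y → Θ → ℝ}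

/-- Infima over shrinking neighbourhoods of a random lower semicontinuous function converge to
its value at the centre, in `L^p`. -/
theorem tendsto_toLp_biInf (hp_top : p ≠ ∞) (hζ : Measurable ζ) (hΨ : IsRandomLSC Ψ) {y : Y}
    (hy : MemLp (fun ω => Ψ y (ζ ω)) p P) {h : Ω → ℝ} (hh : MemLp h p P) {b : ℕ → Set Y}
    (hyb : ∀ n, y ∈ b n) (hb : ∀ O ∈ 𝓝 y, ∀ᶠ n in atTop, b n ⊆ O)
    (hle : ∀ n, ∀ᵐ ω ∂P, ∀ z ∈ b n, h ω ≤ Ψ z (ζ ω)) {V : ℕ → Θ → ℝ}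
    (hV : ∀ n, Measurable (V n)) (hVp : ∀ n, MemLp (fun ω => V n (ζ ω)) p P)
    (hVinf : ∀ n, ∀ᵐ θ ∂(P.map ζ), (V n θ : EReal) = ⨅ z ∈ b n, (Ψ z θ : EReal)) :
    Tendsto (fun n => (hVp n).toLp) atTop (𝓝 hy.toLp) := by
  have hVinf' : ∀ᵐ ω ∂P, ∀ n, (V n (ζ ω) : EReal) = ⨅ z ∈ b n, (Ψ z (ζ ω) : EReal) :=
    ae_all_iff.2 fun n => ae_of_ae_map hζ.aemeasurable (hVinf n)
  refine tendsto_toLp_of_dominated hp_top (f := fun n ω => V n (ζ ω))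
    (g := fun ω => Ψ y (ζ ω)) (fun n => (hV n).comp hζ)
    (hΨ.measurable_uncurry.of_uncurry_left.comp hζ) hVp hy (hh.norm.add hy.norm) (fun n => ?_) ?_
  · filter_upwards [hVinf', hle n] with ω h1 h2
    have h3 : h ω ≤ V n (ζ ω) := by
      rw [← EReal.coe_le_coe_iff, h1]
      exact le_iInf₂ fun z hz => EReal.coe_le_coe_iff.2 (h2 z hz)
    have h4 : V n (ζ ω) ≤ Ψ y (ζ ω) := by
      rw [← EReal.coe_le_coe_iff, h1]
      exact iInf₂_le y (hyb n)
    simp only [Pi.add_apply, Real.norm_eq_abs, abs_le]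
    constructor
    · linarith [neg_abs_le (h ω), abs_nonneg (Ψ y (ζ ω))]
    · linarith [le_abs_self (Ψ y (ζ ω)), abs_nonneg (h ω)]
  · filter_upwards [hVinf'] with ω h1
    refine tendsto_order.2 ⟨fun a ha => ?_, fun a ha => Eventually.of_forall fun n => ?_⟩
    · obtain ⟨c, hac, hc⟩ := exists_between ha
      filter_upwards [hb _ (hΨ.lowerSemicontinuous (ζ ω) y c hc)] with n hn
      refine hac.trans_le ?_
      rw [← EReal.coe_le_coe_iff, h1]
      exact le_iInf₂ fun z hz => EReal.coe_le_coe_iff.2 (le_of_lt (hn hz))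
    · refine lt_of_le_of_lt ?_ ha
      rw [← EReal.coe_le_coe_iff, h1]
      exact iInf₂_le y (hyb n)

variable [IsProbabilityMeasure P] [PolishSpace Y] {ρ : Lp ℝ p P → ℝ}

/-- Almost surely, the empirical risks of a random lower semicontinuous function satisfy the
liminf inequality along all convergent sequences. -/
theorem IsConvexRiskMeasure.ae_eventually_lt_riskOfDistribution (hp_top : p ≠ ∞)
    (hρ : IsConvexRiskMeasure ρ) (hρ_law : IsLawInvariant ρ) (hP : ∃ U, IsUniformVariable P U)
    (hζ : Measurable ζ) (hζs : ∀ i, Measurable (ζs i)) (hindep : iIndepFun ζs P)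
    (hident : ∀ i, IdentDistrib (ζs i) ζ P P) (hΨ : IsRandomLSC Ψ)
    (hΨ_Lp : ∀ y, MemLp (fun ω => Ψ y (ζ ω)) p P)
    (hΨ_below : ∀ y₀, ∃ U ∈ 𝓝 y₀, ∃ h : Ω → ℝ, MemLp h p P ∧
      ∀ᵐ ω ∂P, ∀ y ∈ U, h ω ≤ Ψ y (ζ ω)) :
    ∀ᵐ ω ∂P, ∀ (y : Y) (u : ℕ → Y), Tendsto u atTop (𝓝 y) → ∀ c < ρ (hΨ_Lp y).toLp,
      ∀ᶠ N in atTop,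
        c < riskOfDistribution ρ (empiricalCDF (fun i => Ψ (u N) (ζs i ω)) N) := by
  have hB := TopologicalSpace.isBasis_countableBasis Y
  -- Only basic sets with an `L^p` lower bound count; a point in each supplies the upper bound that
  -- puts the infimum in `L^p`.
  let 𝓖 : Set (Set Y) := {b ∈ TopologicalSpace.countableBasis Y | b.Nonempty ∧
    ∃ h : Ω → ℝ, MemLp h p P ∧ ∀ᵐ ω ∂P, ∀ y ∈ b, h ω ≤ Ψ y (ζ ω)}
  have h𝓖 : Countable 𝓖 :=
    ((TopologicalSpace.countable_countableBasis Y).mono (Set.sep_subset _ _)).to_subtype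
  have hexists : ∀ b : 𝓖, ∃ V : Θ → ℝ, Measurable V ∧ MemLp (fun ω => V (ζ ω)) p P ∧
      ∀ᵐ θ ∂(P.map ζ), (V θ : EReal) = ⨅ y ∈ b.1, (Ψ y θ : EReal) := by
    rintro ⟨b, hb, ⟨y, hy⟩, h, hh, hle⟩
    exact exists_measurable_biInf hΨ.measurable_uncurry hζ (hB.isOpen hb).measurableSet hy
      (hΨ_Lp y) hh hle
  choose V hV hVp hVinf using hexists
  have hconv := ae_all_iff.2 fun b => hρ.ae_tendsto_riskOfDistribution_empiricalCDF hp_top hρ_law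
    hP hindep hident hζ (hV b) (hVp b)
  have hinf : ∀ᵐ ω ∂P, ∀ b i, (V b (ζs i ω) : EReal) = ⨅ y ∈ b.1, (Ψ y (ζs i ω) : EReal) := by
    refine ae_all_iff.2 fun b => ae_all_iff.2 fun i => ?_
    have h : ∀ᵐ θ ∂(P.map (ζs i)), (V b θ : EReal) = ⨅ y ∈ b.1, (Ψ y θ : EReal) := by
      rw [(hident i).map_eq]
      exact hVinf b
    exact ae_of_ae_map (hζs i).aemeasurable h
  filter_upwards [hconv, hinf] with ω h1 h2 y u hu c hc
  -- Once `u N` enters such a `b`, the sample of `V b` lies below that of `Ψ (u N)`, and the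
  -- empirical risks of `V b` converge to a value above `c`.
  suffices h : ∃ b : 𝓖, y ∈ b.1 ∧ c < ρ (hVp b).toLp by
    obtain ⟨b, hyb, hcb⟩ := h
    filter_upwards [hu.eventually_mem ((hB.isOpen b.2.1).mem_nhds hyb),
      (h1 b).eventually_const_lt hcb, eventually_ge_atTop 1] with N hN1 hN2 hN3
    obtain ⟨N, rfl⟩ := Nat.exists_eq_add_of_le' hN3
    refine hN2.trans_le
      (hρ.riskOfDistribution_empiricalCDF_mono hp_top hρ_law hP (fun i => ?_) N)
    rw [← EReal.coe_le_coe_iff, h2]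
    exact iInf₂_le _ hN1
  obtain ⟨U, hU, h, hh, hle⟩ := hΨ_below y
  obtain ⟨O, hO⟩ := (𝓝 y).exists_antitone_basis
  have hb : ∀ n, ∃ b ∈ TopologicalSpace.countableBasis Y, y ∈ b ∧ b ⊆ O n ∩ U := fun n =>
    hB.mem_nhds_iff.1 (inter_mem (hO.1.mem_of_mem trivial) hU)
  choose b hbB hyb hbO using hb
  have hleb : ∀ n, ∀ᵐ ω ∂P, ∀ z ∈ b n, h ω ≤ Ψ z (ζ ω) := fun n => by
    filter_upwards [hle] with ω hω z hz
    exact hω z (hbO n hz).2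
  let b' : ℕ → 𝓖 := fun n => ⟨b n, hbB n, ⟨y, hyb n⟩, h, hh, hleb n⟩
  have hlim := tendsto_toLp_biInf hp_top hζ hΨ (hΨ_Lp y) hh hyb (fun O' hO' => ?_) hleb
    (fun n => hV (b' n)) (fun n => hVp (b' n)) fun n => hVinf (b' n)
  · have h3 := ((hρ.continuous.tendsto _).comp hlim).eventually_const_lt hc
    obtain ⟨n, hn⟩ := h3.exists
    exact ⟨b' n, hyb n, hn⟩
  · obtain ⟨n, -, hn⟩ := hO.1.mem_iff.1 hO'
    filter_upwards [eventually_ge_atTop n] with m hm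
    exact ((hbO m).trans Set.inter_subset_left).trans ((hO.2 hm).trans hn)

end Consistency

/-! ### Mosco-epiconvergence -/

theorem mainTheorem8
    {Ω Θ W Y : Type*}
    [MeasurableSpace Ω] (P : Measure Ω) [IsProbabilityMeasure P] [P.IsComplete]
    (hP : IsNonatomic P)
    [MeasurableSpace Θ]
    (ζ : Ω → Θ) (hζ : Measurable ζ)
    (ζs : ℕ → Ω → Θ) (hζs : ∀ i, Measurable (ζs i))
    (hindep : iIndepFun ζs P) (hident : ∀ i, IdentDistrib (ζs i) ζ P P)
    (p : ℝ≥0∞) (hp_one : 1 ≤ p) (hp_top : p ≠ ∞)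
    [NormedAddCommGroup Y] [NormedSpace ℝ Y] [CompleteSpace Y]
    [MeasurableSpace Y] [BorelSpace Y]
    (Y₀ : Set Y) (hY₀ : IsClosed Y₀) (hY₀_sep : TopologicalSpace.IsSeparable Y₀)
    [NormedAddCommGroup W] [NormedSpace ℝ W] [CompleteSpace W]
    [TopologicalSpace.SeparableSpace W] (hW : IsReflexive W)
    (W₀ : Set W) (hW₀ : IsClosed W₀) (hW₀_conv : Convex ℝ W₀)
    (Ψ : Y₀ → Θ → ℝ) (hΨ : IsRandomLSC Ψ)
    (hΨ_Lp : ∀ y : Y₀, MemLp (fun ω => Ψ y (ζ ω)) p P)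
    (hΨ_below : ∀ y₀ : Y₀, ∃ U ∈ 𝓝 y₀, ∃ h : Ω → ℝ, MemLp h p P ∧
      ∀ᵐ ω ∂P, ∀ y ∈ U, h ω ≤ Ψ y (ζ ω))
    (ρ : Lp ℝ p P → ℝ) (hρ : IsConvexRiskMeasure ρ) (hρ_law : IsLawInvariant ρ)
    (B : W →ₗ[ℝ] Y) (hB : CompletelyContinuous B) (hBW₀ : Set.MapsTo B W₀ Y₀) :
    ∀ᵐ ω ∂P, MoscoEpiconverges
      (fun (N : ℕ) (w : W₀) =>
        ((riskOfDistribution ρ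
          (empiricalCDF (fun i => Ψ ⟨B w, hBW₀ w.2⟩ (ζs i ω)) N) : ℝ) : EReal))
      (fun w : W₀ => ((ρ ((hΨ_Lp ⟨B w, hBW₀ w.2⟩).toLp) : ℝ) : EReal)) := by
  have : Fact (1 ≤ p) := ⟨hp_one⟩
  have : CompleteSpace Y₀ := hY₀.completeSpace_coe
  have : SecondCountableTopology Y₀ := hY₀_sep.secondCountableTopology
  have : SecondCountableTopology W := UniformSpace.secondCountable_of_separable W
  have hU := hP.exists_uniform
  obtain ⟨D, hDc, hD⟩ := exists_countable_dense_graph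
    fun w : W₀ => ρ ((hΨ_Lp ⟨B w, hBW₀ w.2⟩).toLp)
  have hconv := (ae_ball_iff hDc).2 fun w (_ : w ∈ D) =>
    hρ.ae_tendsto_riskOfDistribution_empiricalCDF hp_top hρ_law hU hindep hident hζ
      (hΨ.measurable_uncurry.of_uncurry_left (x := ⟨B w, hBW₀ w.2⟩)) (hΨ_Lp ⟨B w, hBW₀ w.2⟩)
  filter_upwards [hconv, hρ.ae_eventually_lt_riskOfDistribution hp_top hρ_law hU hζ hζs hindep
    hident hΨ hΨ_Lp hΨ_below] with ω h1 h2 w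
  constructor
  · intro u hu
    -- Complete continuity turns weak convergence in `W` into convergence in `Y₀`.
    have hBu : Tendsto (fun k => (⟨B (u k), hBW₀ (u k).2⟩ : Y₀)) atTop
        (𝓝 ⟨B w, hBW₀ w.2⟩) := tendsto_subtype_rng.2 (hB _ _ hu)
    refine le_of_forall_lt fun c hc => ?_
    obtain ⟨a, hca, ha⟩ := EReal.lt_iff_exists_real_btwn.1 hc
    refine hca.trans_le (le_liminf_of_le (by isBoundedDefault) ?_)
    filter_upwards [h2 _ _ hBu a (EReal.coe_lt_coe_iff.1 ha)] with N hN
    exact EReal.coe_le_coe_iff.2 hN.le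
  · obtain ⟨d, hdD, hd, hφd⟩ := hD w
    obtain ⟨u, hu, hlim⟩ := exists_recovery_sequence (φs := fun N (w : W₀) =>
      riskOfDistribution ρ (empiricalCDF (fun i => Ψ ⟨B w, hBW₀ w.2⟩ (ζs i ω)) N))
      (φ := fun w : W₀ => ρ ((hΨ_Lp ⟨B w, hBW₀ w.2⟩).toLp)) hd hφd
      fun k => h1 (d k) (hdD k)
    exact ⟨u, (continuous_subtype_val.tendsto _).comp hu, hlim⟩
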